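/- Let $m$ be a cubefree integer with $m \neq \pm 1$, let $K = \mathbb{Q}(\omega)$ with $\omega^3 = m$ be the corresponding pure cubic number field, and let $E$ be the elliptic curve $y^2 = x^3 - m$ over $\mathbb{Q}$. (1) Every affine rational point $P \in E(\mathbb{Q})$ can be written in the form $P = (r/t^2, s/t^3)$ with integers $r, s, t$ such that $t \neq 0$ and $\gcd(r,t) = \gcd(s,t) = 1$. (Call this a reduced form of $P$.) (2) For every reduced form of an affine point $P$ one has $r - t^2\omega \neq 0$, and the map $\alpha : E(\mathbb{Q}) \to K^\times/K^{\times 2}$ that sends the point at infinity to $1$ and every affine point $P = (r/t^2, s/t^3)$ in reduced form to $(r - t^2\omega)K^{\times 2}$ is well defined and is a group homomorphism. (3) The kernel of $\alpha$ contains $2E(\mathbb{Q})$. More exactly, if $P = (r/t^2, s/t^3)$ is an affine point in reduced form, and $\beta = (r - t^2\omega)^2 - 3(t^2\omega)^2$, then $s \neq 0$, $\beta \neq 0$, the point $2P$ is affine, its $x$-coordinate satisfies $x(2P) - \omega = \bigl(\beta/(2ts)\bigr)^2$, and $\alpha(2P)$ is represented by $\beta^2$. (4) If $P = (r/t^2,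 s/t^3)$ is an affine point in reduced form with $P \in \ker\alpha$ and $t$ even, then $P = 2Q$ for some $Q \in E(\mathbb{Q})$. -/

import Mathlib

/-- A cubefree integer: no cube of a non-unit divides it (so `0` is not cubefree). -/
def IsCubefree (m : ℤ) : Prop := ∀ d : ℤ, d ^ 3 ∣ m → IsUnit d

/-- The Weierstrass curve `y² = x³ - m` over `ℚ`. -/
def mordellCurve (m : ℤ) : WeierstrassCurve ℚ where
  a₁ := 0
  a₂ := 0
  a₃ := 0
  a₄ := 0
  a₆ := -(m : ℚ)

/-- The curve `y² = x³ - m` is an elliptic curve for `m ≠ 0`. -/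
theorem mordellCurve_isElliptic {m : ℤ} (hm : m ≠ 0) : (mordellCurve m).IsElliptic := by
  refine ⟨isUnit_iff_ne_zero.mpr ?_⟩
  have h : (m : ℚ) ≠ 0 := by exact_mod_cast hm
  simp [mordellCurve, WeierstrassCurve.Δ, WeierstrassCurve.b₂, WeierstrassCurve.b₄,
    WeierstrassCurve.b₆, WeierstrassCurve.b₈, h]

/-- The affine equation of the curve is `y² = x³ - m`. -/
theorem mordellCurve_equation_iff (m : ℤ) (x y : ℚ) :
    (mordellCurve m).toAffine.Equation x y ↔ y ^ 2 = x ^ 3 - m := by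
  simp [WeierstrassCurve.Affine.equation_iff, mordellCurve, sub_eq_add_neg]

/-- For `m ≠ 0`, the (nonsingular) affine points are exactly the solutions of `y² = x³ - m`. -/
theorem mordellCurve_nonsingular_iff {m : ℤ} (hm : m ≠ 0) (x y : ℚ) :
    (mordellCurve m).toAffine.Nonsingular x y ↔ y ^ 2 = x ^ 3 - m := by
  have := mordellCurve_isElliptic hm
  rw [← mordellCurve_equation_iff]
  exact (WeierstrassCurve.Affine.equation_iff_nonsingular).symm

/-- The group `E(ℚ)` of rational points (with the point at infinity) on `E : y² = x³ - m`. -/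
abbrev MordellPoint (m : ℤ) : Type := (mordellCurve m).toAffine.Point

/-- The group `Kˣ / Kˣ²` of square classes of a field. -/
abbrev SquareClasses (K : Type*) [Field K] : Type _ := Kˣ ⧸ (powMonoidHom 2 : Kˣ →* Kˣ).range

/-- `(x, y) = (r / t², s / t³)` with integers `r, s, t` such that
`t ≠ 0` and `gcd(r, t) = gcd(s, t) = 1`. -/
def IsReducedForm (x y : ℚ) (r s t : ℤ) : Prop :=
  t ≠ 0 ∧ Int.gcd r t = 1 ∧ Int.gcd s t = 1 ∧
    x = (r : ℚ) / (t : ℚ) ^ 2 ∧ y = (s : ℚ) / (t : ℚ) ^ 3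

/-! Since `m` is not a rational cube, `1, ω, ω²` are independent over `ℚ` and `x - ω` never vanishes
for rational `x`. As `r - t²ω = t²(x - ω)`, the map `α` is `P ↦ x(P) - ω` modulo squares. It is
multiplicative because a line meets the curve in three points whose values of `x - ω` multiply to a
square (`mul_sub_root_mul_addX_sub_root`). Conversely, write a square root of `x(P) - ω` as `a + bω
+ cω²`: comparing coefficients shows that `(b/c, 1/c)` lies on the curve and doubles to `±P`
(`exists_eq_two_nsmul_of_sub_root_eq_sq`). -/

open Polynomial in
/-- If `m` is not a cube in `ℚ` and `ω³ = m`, then `1`, `ω`, `ω²` are linearly independent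
over `ℚ`. -/
theorem eq_zero_of_add_mul_root_eq_zero {K : Type*} [Field K] [CharZero K] {m : ℚ}
    (hm : ∀ q : ℚ, q ^ 3 ≠ m) {ω : K} (hω : ω ^ 3 = (m : K)) {a b c : ℚ}
    (h : (a : K) + b * ω + c * ω ^ 2 = 0) : a = 0 ∧ b = 0 ∧ c = 0 := by
  have hirr : Irreducible (X ^ 3 - C m : ℚ[X]) :=
    X_pow_sub_C_irreducible_of_prime Nat.prime_three hm
  have hmin : X ^ 3 - C m = minpoly ℚ ω :=
    minpoly.eq_of_irreducible_of_monic hirr (by simp [hω])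
      (monic_X_pow_sub_C m (by norm_num))
  have hp : (C a + C b * X + C c * X ^ 2 : ℚ[X]) = 0 := by
    by_contra hne
    have hdeg := natDegree_le_of_dvd
      (minpoly.dvd ℚ ω (p := C a + C b * X + C c * X ^ 2) (by simpa using h)) hne
    rw [← hmin, natDegree_X_pow_sub_C] at hdeg
    have : (C a + C b * X + C c * X ^ 2 : ℚ[X]).natDegree ≤ 2 := by compute_degree
    omega
  refine ⟨?_, ?_, ?_⟩
  · simpa using congrArg (coeff · 0) hp
  · simpa [coeff_X, coeff_C] using congrArg (coeff · 1) hp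
  · simpa [coeff_X, coeff_C] using congrArg (coeff · 2) hp

open Polynomial in
/-- Every element of `ℚ(ω)` with `ω³ = m` is of the form `a + bω + cω²`. -/
theorem exists_eq_add_mul_root {K : Type*} [Field K] [CharZero K] {m : ℚ} {ω : K}
    (hω : ω ^ 3 = (m : K)) (hK : IntermediateField.adjoin ℚ {ω} = ⊤) (z : K) :
    ∃ a b c : ℚ, z = (a : K) + b * ω + c * ω ^ 2 := by
  have hroot : aeval ω (X ^ 3 - C m : ℚ[X]) = 0 := by simp [hω]
  have hmonic : (X ^ 3 - C m : ℚ[X]).Monic := monic_X_pow_sub_C m (by norm_num)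
  have halg : IsAlgebraic ℚ ω := ⟨_, hmonic.ne_zero, hroot⟩
  have hz : z ∈ (IntermediateField.adjoin ℚ {ω}).toSubalgebra := by rw [hK]; trivial
  rw [IntermediateField.adjoin_simple_toSubalgebra_of_isAlgebraic halg,
    Algebra.adjoin_singleton_eq_range_aeval] at hz
  obtain ⟨p, rfl⟩ := hz
  have hdeg : (p %ₘ (X ^ 3 - C m)).natDegree < 3 := by
    have := natDegree_modByMonic_lt p hmonic (by
      intro h
      have := congrArg natDegree h
      rw [natDegree_X_pow_sub_C] at this
      simp at this)
    rwa [natDegree_X_pow_sub_C] at this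
  refine ⟨(p %ₘ (X ^ 3 - C m)).coeff 0, (p %ₘ (X ^ 3 - C m)).coeff 1,
    (p %ₘ (X ^ 3 - C m)).coeff 2, ?_⟩
  have : aeval ω p = aeval ω (p %ₘ (X ^ 3 - C m)) :=
    (aeval_modByMonic_eq_self_of_root hroot).symm
  change aeval ω p = _
  rw [this, aeval_eq_sum_range' hdeg]
  simp [Finset.sum_range_succ, Algebra.smul_def]

/-- A cubefree integer other than `±1` is not the cube of a rational number. -/
theorem IsCubefree.rat_pow_three_ne {m : ℤ} (hm : IsCubefree m) (h1 : m ≠ 1) (h2 : m ≠ -1)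
    (q : ℚ) : q ^ 3 ≠ m := by
  intro h
  have hden : q.den = 1 := by
    have := congrArg Rat.den h
    simpa using this
  have hq : (q.num : ℚ) = q := Rat.coe_int_num_of_den_eq_one hden
  rw [← hq] at h
  have h' : q.num ^ 3 = m := by exact_mod_cast h
  rcases Int.isUnit_iff.mp (hm q.num (by rw [h'])) with h3 | h3 <;> rw [h3] at h'
  · exact h1 (by rw [← h']; norm_num)
  · exact h2 (by rw [← h']; norm_num)

/-- Every rational solution of `y² = x³ - m` has a reduced form. -/
theorem exists_isReducedForm {m : ℤ} {x y : ℚ} (h : y ^ 2 = x ^ 3 - m) :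
    ∃ r s t : ℤ, IsReducedForm x y r s t := by
  -- Subtracting an integer does not change the denominator of `x³`. The quotient `t` of the two
  -- denominators then satisfies `x.den = t²`.
  have hden : y.den ^ 2 = x.den ^ 3 := by
    simpa [Rat.sub_intCast_den] using congrArg Rat.den h
  obtain ⟨t, ht⟩ : x.den ∣ y.den :=
    (Nat.pow_dvd_pow_iff two_ne_zero).mp (hden ▸ pow_dvd_pow _ (by norm_num))
  have hx0 : 0 < x.den := x.den_pos
  have hxt : x.den = t ^ 2 := by
    have : x.den ^ 2 * t ^ 2 = x.den ^ 2 * x.den := by rw [← mul_pow, ← ht, hden]; ring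
    exact (Nat.eq_of_mul_eq_mul_left (by positivity) this).symm
  have hyt : y.den = t ^ 3 := by rw [ht, hxt]; ring
  refine ⟨x.num, y.num, t, ?_, ?_, ?_, ?_, ?_⟩
  · rintro h0
    have : t = 0 := by exact_mod_cast h0
    simp [this] at hxt
  · have := x.reduced
    rw [hxt] at this
    simpa [Int.gcd, Nat.Coprime] using
      Nat.Coprime.coprime_dvd_right (dvd_pow_self t two_ne_zero) this
  · have := y.reduced
    rw [hyt] at this
    simpa [Int.gcd, Nat.Coprime] using
      Nat.Coprime.coprime_dvd_right (dvd_pow_self t three_ne_zero) this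
  · conv_lhs => rw [← Rat.num_div_den x, hxt]
    push_cast; rfl
  · conv_lhs => rw [← Rat.num_div_den y, hyt]
    push_cast; rfl

/-- The chord-tangent relation: if `x₃` is the `x`-coordinate of `P₁ + P₂`, then
`(x₁ - w)(x₂ - w)(x₃ - w)` is a square whenever `w³ = m`. -/
theorem mul_sub_root_mul_addX_sub_root {m : ℤ} {K : Type*} [Field K] [CharZero K] {w : K}
    (hw : w ^ 3 = (m : K)) {x₁ y₁ x₂ y₂ : ℚ}
    (h₁ : (mordellCurve m).toAffine.Equation x₁ y₁)
    (h₂ : (mordellCurve m).toAffine.Equation x₂ y₂)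
    (hxy : ¬(x₁ = x₂ ∧ y₁ = (mordellCurve m).toAffine.negY x₂ y₂)) :
    ((x₁ : K) - w) * (x₂ - w) * (((mordellCurve m).toAffine.addX x₁ x₂
      ((mordellCurve m).toAffine.slope x₁ x₂ y₁ y₂) : ℚ) - w) =
      (((mordellCurve m).toAffine.slope x₁ x₂ y₁ y₂ : ℚ) * (w - x₁) + y₁) ^ 2 := by
  -- Substituting the line into `X³ - m - Y²` gives the cubic with roots `x₁, x₂, x₃`; at `w` the
  -- term `X³ - m` vanishes, leaving minus the square of the line.
  have h := congrArg (Polynomial.aeval w)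
    (WeierstrassCurve.Affine.addPolynomial_slope h₁ h₂ hxy)
  rw [WeierstrassCurve.Affine.addPolynomial_eq] at h
  generalize (mordellCurve m).toAffine.addX x₁ x₂
      ((mordellCurve m).toAffine.slope x₁ x₂ y₁ y₂) = x₃ at h ⊢
  generalize (mordellCurve m).toAffine.slope x₁ x₂ y₁ y₂ = ℓ at h ⊢
  simp [Cubic.toPoly, mordellCurve] at h
  linear_combination -h - hw

/-- Doubling a point of `y² = x³ - m` that is not of order `2`. -/
theorem mordellCurve_two_nsmul_some {m : ℤ} {x y : ℚ}
    (h : (mordellCurve m).toAffine.Nonsingular x y) (hy : y ≠ 0) :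
    ∃ (x' y' : ℚ) (h' : (mordellCurve m).toAffine.Nonsingular x' y'),
      2 • WeierstrassCurve.Affine.Point.some x y h =
        WeierstrassCurve.Affine.Point.some x' y' h' ∧
      x' = (x ^ 4 + 8 * m * x) / (2 * y) ^ 2 := by
  have hne : y ≠ (mordellCurve m).toAffine.negY x y := by
    intro h0
    simp [WeierstrassCurve.Affine.negY, mordellCurve] at h0
    exact hy (by linarith)
  have heq := (mordellCurve_equation_iff m x y).mp h.1
  refine ⟨_, _, _, (two_nsmul _).trans
    (WeierstrassCurve.Affine.Point.add_self_of_Y_ne hne), ?_⟩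
  rw [WeierstrassCurve.Affine.slope_of_Y_ne rfl hne]
  simp only [WeierstrassCurve.Affine.addX, WeierstrassCurve.Affine.negY, mordellCurve]
  have h2 : y - (-y - 0 * x - 0) = 2 * y := by ring
  rw [h2]
  field_simp
  linear_combination (-8 * x) * heq

theorem SquareClasses.mk_eq_mk_of_mul_sq {K : Type*} [Field K] {u v : Kˣ} {z : K}
    (h : (u : K) * z ^ 2 = v) :
    (QuotientGroup.mk u : SquareClasses K) = QuotientGroup.mk v := by
  have hz : z ≠ 0 := by
    rintro rfl
    exact v.ne_zero (by rw [← h]; ring)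
  refine QuotientGroup.eq.mpr ⟨Units.mk0 z hz, ?_⟩
  ext
  simp [← h]

theorem SquareClasses.mk_eq_one_iff {K : Type*} [Field K] {u : Kˣ} :
    (QuotientGroup.mk u : SquareClasses K) = 1 ↔ ∃ z : K, (u : K) = z ^ 2 := by
  constructor
  · intro h
    obtain ⟨z, hz⟩ := (QuotientGroup.eq_one_iff u).mp h
    exact ⟨z, by rw [← hz]; simp⟩
  · rintro ⟨z, hz⟩
    exact (mk_eq_mk_of_mul_sq (u := 1) (z := z) (by simp [hz])).symm

/-- The square class of `x(P) - ω`. -/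
noncomputable def xSubClass {m : ℤ} {K : Type*} [Field K] [CharZero K] {ω : K}
    (hω : ∀ q : ℚ, (q : K) - ω ≠ 0) : MordellPoint m → SquareClasses K
  | .zero => 1
  | .some x _ _ => QuotientGroup.mk (Units.mk0 ((x : K) - ω) (hω x))

/-- The `2`-descent homomorphism `P ↦ x(P) - ω` to the square classes of `K`. -/
noncomputable def xSubHom {m : ℤ} {K : Type*} [Field K] [CharZero K] {ω : K}
    (hω : ∀ q : ℚ, (q : K) - ω ≠ 0) (hm : ω ^ 3 = (m : K)) :
    Multiplicative (MordellPoint m) →* SquareClasses K :=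
  MonoidHom.mk' (fun P => xSubClass hω P.toAdd) <| by
    intro P Q
    change xSubClass hω (P.toAdd + Q.toAdd) = xSubClass hω P.toAdd * xSubClass hω Q.toAdd
    generalize P.toAdd = P
    generalize Q.toAdd = Q
    rcases P with _ | ⟨x₁, y₁, h₁⟩
    · change xSubClass hω (0 + Q) = 1 * _
      rw [zero_add]
      exact (one_mul (M := SquareClasses K) _).symm
    rcases Q with _ | ⟨x₂, y₂, h₂⟩
    · change xSubClass hω (_ + 0) = _ * 1
      rw [add_zero]
      exact (mul_one (M := SquareClasses K) _).symm
    by_cases hxy : x₁ = x₂ ∧ y₁ = (mordellCurve m).toAffine.negY x₂ y₂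
    · rw [WeierstrassCurve.Affine.Point.add_of_Y_eq hxy.1 hxy.2]
      obtain ⟨rfl, -⟩ := hxy
      exact (SquareClasses.mk_eq_one_iff (u := Units.mk0 _ (hω x₁) * Units.mk0 _ (hω x₁)).mpr
        ⟨(x₁ : K) - ω, by simp [sq]⟩).symm
    · rw [WeierstrassCurve.Affine.Point.add_some hxy]
      have key := mul_sub_root_mul_addX_sub_root hm h₁.1 h₂.1 hxy
      -- Dividing the chord relation by `x₃ - ω` explains `z`.
      refine SquareClasses.mk_eq_mk_of_mul_sq (v := Units.mk0 _ (hω x₁) * Units.mk0 _ (hω x₂))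
        (z := (((mordellCurve m).toAffine.slope x₁ x₂ y₁ y₂ : ℚ) * (ω - x₁) + y₁) /
          (((mordellCurve m).toAffine.addX x₁ x₂
            ((mordellCurve m).toAffine.slope x₁ x₂ y₁ y₂) : ℚ) - ω)) ?_
      have h3 := hω ((mordellCurve m).toAffine.addX x₁ x₂
        ((mordellCurve m).toAffine.slope x₁ x₂ y₁ y₂))
      rw [div_pow, ← key, Units.val_mk0, Units.val_mul, Units.val_mk0, Units.val_mk0]
      field_simp

/-- If `x(P) - ω` is a square in `ℚ(ω)`, then `P` is divisible by `2`. -/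
theorem exists_eq_two_nsmul_of_sub_root_eq_sq {m : ℤ} (hm : ∀ q : ℚ, q ^ 3 ≠ m) {K : Type*}
    [Field K] [CharZero K] {ω : K} (hω : ω ^ 3 = (m : K))
    (hK : IntermediateField.adjoin ℚ {ω} = ⊤) {x y : ℚ}
    (h : (mordellCurve m).toAffine.Nonsingular x y) {z : K} (hz : (x : K) - ω = z ^ 2) :
    ∃ Q : MordellPoint m, WeierstrassCurve.Affine.Point.some x y h = 2 • Q := by
  have hω' : ω ^ 3 = ((m : ℚ) : K) := by rw [hω]; simp
  obtain ⟨a, b, c, rfl⟩ := exists_eq_add_mul_root hω' hK z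
  -- These are the coefficients of `z² - (x - ω)` after reducing by `ω³ = m`.
  obtain ⟨h0, h1, h2⟩ := eq_zero_of_add_mul_root_eq_zero hm hω'
    (a := a ^ 2 + 2 * b * c * m - x) (b := 2 * a * b + c ^ 2 * m + 1) (c := b ^ 2 + 2 * a * c) (by
      push_cast
      linear_combination -hz - (2 * b * c + c ^ 2 * ω) * hω)
  have hc : c ≠ 0 := by
    rintro rfl
    have hb : b = 0 := by simpa using h2
    simp [hb] at h1
  have hm0 : m ≠ 0 := by
    rintro rfl
    exact hm 0 (by simp)
  have ha : a = -b ^ 2 / (2 * c) := by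
    field_simp
    linear_combination h2
  -- For a point `(u, v)`, a square root of `x(2(u, v)) - ω` is `(u² - 2uω - 2ω²)/(2v)`. Matching
  -- coefficients gives `u = b/c` and `v = 1/c` up to sign.
  have hQ : (mordellCurve m).toAffine.Nonsingular (b / c) (1 / c) := by
    rw [mordellCurve_nonsingular_iff hm0]
    rw [ha] at h1
    field_simp at h1 ⊢
    linear_combination h1
  obtain ⟨x', y', h', hdbl, hx'⟩ := mordellCurve_two_nsmul_some hQ (by positivity)
  have hxx : x = x' := by
    rw [hx']
    rw [ha] at h0
    field_simp at h0 ⊢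
    linear_combination -h0
  subst hxx
  -- The `x`-coordinate fixes the double only up to sign; in the second case `-Q` works.
  rcases WeierstrassCurve.Affine.Y_eq_of_X_eq h.1 h'.1 rfl with hy | hy
  · subst hy
    exact ⟨_, hdbl.symm⟩
  · refine ⟨-WeierstrassCurve.Affine.Point.some _ _ hQ, ?_⟩
    refine Eq.trans ?_ (neg_nsmul _ 2).symm
    rw [hdbl, WeierstrassCurve.Affine.Point.neg_some]
    subst hy
    rfl

theorem mainTheorem5 (m : ℤ) (hcf : IsCubefree m) (hm1 : m ≠ 1) (hm2 : m ≠ -1)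
    (K : Type*) [Field K] [NumberField K] (ω : K) (hω : ω ^ 3 = (m : K))
    (hK : IntermediateField.adjoin ℚ {ω} = ⊤) :
    -- every rational affine point has a reduced form
    (∀ x y : ℚ, y ^ 2 = x ^ 3 - (m : ℚ) → ∃ r s t : ℤ, IsReducedForm x y r s t) ∧
    -- the map `α` is well defined and is a group homomorphism
    ∃ α : Multiplicative (MordellPoint m) →* SquareClasses K,
      (∀ (x y : ℚ) (h : (mordellCurve m).toAffine.Nonsingular x y) (r s t : ℤ),
        IsReducedForm x y r s t →
          ∃ u : Kˣ, (u : K) = (r : K) - (t : K) ^ 2 * ω ∧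
            α (Multiplicative.ofAdd (WeierstrassCurve.Affine.Point.some x y h)) =
              QuotientGroup.mk u) ∧
      -- the kernel contains `2E(ℚ)`
      (∀ P : MordellPoint m, Multiplicative.ofAdd (2 • P) ∈ α.ker) ∧
      -- `α(2P)` is represented by `β²`; more precisely, `x(2P) - ω = (β / (2ts))²`
      (∀ (x y : ℚ) (h : (mordellCurve m).toAffine.Nonsingular x y) (r s t : ℤ),
        IsReducedForm x y r s t →
          s ≠ 0 ∧
          ∃ β : Kˣ, (β : K) = ((r : K) - (t : K) ^ 2 * ω) ^ 2 - 3 * ((t : K) ^ 2 * ω) ^ 2 ∧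
            α (Multiplicative.ofAdd (2 • WeierstrassCurve.Affine.Point.some x y h)) =
              QuotientGroup.mk (β ^ 2) ∧
            ∃ (x' y' : ℚ) (h' : (mordellCurve m).toAffine.Nonsingular x' y'),
              2 • WeierstrassCurve.Affine.Point.some x y h =
                WeierstrassCurve.Affine.Point.some x' y' h' ∧
              (x' : K) - ω = ((β : K) / (2 * (t : K) * (s : K))) ^ 2) ∧
      -- points in the kernel with even `t` are divisible by `2`
      (∀ (x y : ℚ) (h : (mordellCurve m).toAffine.Nonsingular x y) (r s t : ℤ),
        IsReducedForm x y r s t → Even t →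
          Multiplicative.ofAdd (WeierstrassCurve.Affine.Point.some x y h) ∈ α.ker →
            ∃ Q : MordellPoint m, WeierstrassCurve.Affine.Point.some x y h = 2 • Q) := by
  have hcube := hcf.rat_pow_three_ne hm1 hm2
  have hm0 : m ≠ 0 := by
    rintro rfl
    exact hcube 0 (by simp)
  have hne : ∀ q : ℚ, (q : K) - ω ≠ 0 := by
    intro q hq
    refine hcube q ?_
    rw [← sub_eq_zero.mp hq] at hω
    exact_mod_cast hω
  refine ⟨fun x y h => exists_isReducedForm h, xSubHom hne hω, ?_, ?_, ?_, ?_⟩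
  · rintro x y h r s t ⟨ht, -, -, hx, -⟩
    have htK : (t : K) ≠ 0 := by exact_mod_cast ht
    have hmul : ((x : K) - ω) * (t : K) ^ 2 = (r : K) - (t : K) ^ 2 * ω := by
      rw [hx]
      push_cast
      field_simp
    have hu : (r : K) - (t : K) ^ 2 * ω ≠ 0 := by
      rw [← hmul]
      exact mul_ne_zero (hne x) (pow_ne_zero 2 htK)
    exact ⟨Units.mk0 _ hu, rfl, SquareClasses.mk_eq_mk_of_mul_sq
      (u := Units.mk0 _ (hne x)) (z := (t : K)) (by simpa using hmul)⟩
  · intro P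
    rw [MonoidHom.mem_ker, ofAdd_nsmul, map_pow]
    induction xSubHom hne hω (Multiplicative.ofAdd P) using QuotientGroup.induction_on with
    | H u => exact SquareClasses.mk_eq_one_iff (u := u ^ 2).mpr ⟨u, by simp⟩
  · rintro x y h r s t ⟨ht, -, -, hx, hy⟩
    have htK : (t : K) ≠ 0 := by exact_mod_cast ht
    have htQ : (t : ℚ) ≠ 0 := by exact_mod_cast ht
    have heq := (mordellCurve_nonsingular_iff hm0 x y).mp h
    -- If `s = 0`, then `m = x³` is a rational cube.
    have hs : s ≠ 0 := by
      rintro rfl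
      refine hcube x ?_
      simp only [Int.cast_zero, zero_div] at hy
      rw [hy] at heq
      linear_combination -heq
    have hsK : (s : K) ≠ 0 := by exact_mod_cast hs
    have hsQ : (s : ℚ) ≠ 0 := by exact_mod_cast hs
    have hy0 : y ≠ 0 := by
      rw [hy]
      positivity
    obtain ⟨x', y', h', hdbl, hx'⟩ := mordellCurve_two_nsmul_some h hy0
    have hsq : (x' : K) - ω = ((((r : K) - (t : K) ^ 2 * ω) ^ 2 -
        3 * ((t : K) ^ 2 * ω) ^ 2) / (2 * (t : K) * (s : K))) ^ 2 := by
      have heqK : (s : K) ^ 2 = (r : K) ^ 3 - m * (t : K) ^ 6 := by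
        rw [hx, hy] at heq
        field_simp at heq
        rw [mul_comm (m : K)]
        exact_mod_cast heq
      rw [hx', hx, hy]
      push_cast
      field_simp
      linear_combination (-4 * (t : K) ^ 2 * ω) * heqK -
        (4 * (t : K) ^ 8 * ω + 8 * (r : K) * (t : K) ^ 6) * hω
    have hβ : ((r : K) - (t : K) ^ 2 * ω) ^ 2 - 3 * ((t : K) ^ 2 * ω) ^ 2 ≠ 0 := by
      intro h0
      rw [h0] at hsq
      exact hne x' (by simpa using hsq)
    refine ⟨hs, Units.mk0 _ hβ, rfl, ?_, x', y', h', hdbl, hsq⟩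
    rw [hdbl]
    refine SquareClasses.mk_eq_mk_of_mul_sq (u := Units.mk0 _ (hne x'))
      (z := 2 * (t : K) * (s : K)) ?_
    simp only [Units.val_mk0, Units.val_pow_eq_pow_val]
    rw [hsq]
    field_simp
  · intro x y h r s t _ _ hker
    obtain ⟨z, hz⟩ := SquareClasses.mk_eq_one_iff (u := Units.mk0 _ (hne x)).mp hker
    exact exists_eq_two_nsmul_of_sub_root_eq_sq hcube hω hK h hz
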